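/- Let $K$ be a field, let $\mathcal T$ be a finite tree with vertex set $V$, and let $S=K[x_v : v\in V]$. For $u \in V$ let $N[u]$ be the closed neighborhood of $u$, that is, $u$ together with its neighbors. The closed neighborhood complex $\mathcal N(\mathcal T)$ is the simplicial complex on $V$ whose facets are the inclusion-minimal sets among the closed neighborhoods $N[u]$, $u\in V$. A $k$-matching of $\mathcal N(\mathcal T)$ is a set of $k$ pairwise disjoint facets of $\mathcal N(\mathcal T)$, and $\nu$ denotes the largest $k$ for which a $k$-matching exists. Let $J = NI(\mathcal T)\subset S$ be the closed neighborhood ideal, generated by the monomials $\prod_{v\in F}x_v$ with $F$ a facet of $\mathcal N(\mathcal T)$, and let $J^{[\nu]}$ be its $\nu$-th squarefree power, the ideal generated by the squarefree monomials that belong to $J^{\nu}$. Condition (C1): $\mathcal T$ contains no path $r_1,r,s,t,t_1$ on five distinct vertices with $\deg_{\mathcal T}(s)\ge 3$ for which there is a $(\nu-1)$-matching $Y$ of $\mathcal N(\mathcal T)$ such that $\{N[r]\}\cup Y$ and $\{N[t]\}\cup Y$ are two distinct $\nu$-matchings of $\mathcal N(\mathcal T)$. A homogeneous ideal $I\subset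 S$ is componentwise linear if for every $j$ the ideal $I_{\langle j\rangle}$ generated by the homogeneous elements of degree $j$ of $I$ has a linear resolution, that is, there is a $d$ such that the graded Betti numbers $\beta_{i,k}(I_{\langle j\rangle})$ vanish for all $i\ge 0$ and all $k\ne i+d$. **Theorem.** If $\mathcal T$ does not satisfy Condition (C1), then $J^{[\nu]}$ is not componentwise linear. -/

import Mathlib

noncomputable section

namespace CNI

/-! ### The closed neighborhood complex and its matchings -/

section Complex

variable {V : Type*} [Fintype V] [DecidableEq V]

/-- The closed neighborhood `N_G[u]`. -/
def closedNbhd (G : SimpleGraph V) [DecidableRel G.Adj] (u : V) : Finset V :=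
  insert u (G.neighborFinset u)

/-- The closed neighborhood complex `𝒩(G)`: its faces are the (nonempty) subsets of those closed
neighborhoods of `G` which do not properly contain another closed neighborhood of `G`. -/
def closedNbhdComplex (G : SimpleGraph V) [DecidableRel G.Adj] : PreAbstractSimplicialComplex V where
  faces := {F | F.Nonempty ∧
    ∃ u, F ⊆ closedNbhd G u ∧ ∀ v, ¬ closedNbhd G v ⊂ closedNbhd G u}
  isRelLowerSet_faces := by
    rintro F ⟨hF, u, hu, hmin⟩
    exact ⟨hF, fun E hE hne => ⟨hne, u, hE.trans hu, hmin⟩⟩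

/-- The set `ℱ(Δ)` of facets, i.e. of maximal faces. -/
def facets (Δ : PreAbstractSimplicialComplex V) : Set (Finset V) :=
  {F | Maximal (fun E => E ∈ Δ.faces) F}

/-- A matching of `Δ` is a set of pairwise disjoint facets; it is a `k`-matching if it consists
of `k` facets. -/
def IsMatching (Δ : PreAbstractSimplicialComplex V) (k : ℕ) (M : Finset (Finset V)) : Prop :=
  (∀ F ∈ M, F ∈ facets Δ) ∧ (∀ F ∈ M, ∀ E ∈ M, F ≠ E → Disjoint F E) ∧ M.card = k

/-- The matching number `ν(Δ)`: the largest `k` for which `Δ` has a `k`-matching. (The set below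
is bounded since `V` is finite, and it contains `0`.) -/
def matchingNumber (Δ : PreAbstractSimplicialComplex V) : ℕ :=
  sSup {k | ∃ M, IsMatching Δ k M}

/-- Condition (C1): `T` has no path `r₁, r, s, t, t₁` with `deg s ≥ 3` for which there is a
`(ν - 1)`-matching `Y` of `𝒩(T)` such that `{N[r]} ∪ Y` and `{N[t]} ∪ Y` are two distinct
`ν`-matchings. -/
def ConditionC1 (T : SimpleGraph V) [DecidableRel T.Adj] : Prop :=
  ¬ ∃ r₁ r s t t₁ : V,
    [r₁, r, s, t, t₁].Nodup ∧ T.Adj r₁ r ∧ T.Adj r s ∧ T.Adj s t ∧ T.Adj t t₁ ∧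
    3 ≤ T.degree s ∧
    ∃ (k : ℕ) (Y : Finset (Finset V)),
      k + 1 = matchingNumber (closedNbhdComplex T) ∧
      IsMatching (closedNbhdComplex T) k Y ∧
      IsMatching (closedNbhdComplex T) (matchingNumber (closedNbhdComplex T))
        (insert (closedNbhd T r) Y) ∧
      IsMatching (closedNbhdComplex T) (matchingNumber (closedNbhdComplex T))
        (insert (closedNbhd T t) Y) ∧
      insert (closedNbhd T r) Y ≠ insert (closedNbhd T t) Y

end Complex

/-! ### Monomial ideals -/

section Ideals

variable {V : Type*} (K : Type*) [Field K]

/-- The squarefree monomial `x_A`, the product of the variables indexed by `A`. -/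
def sqfreeMonomial (A : Finset V) : MvPolynomial V K :=
  ∏ u ∈ A, MvPolynomial.X u

/-- The facet ideal `I(Δ) = (x_F : F ∈ ℱ(Δ))`. -/
def facetIdeal (Δ : PreAbstractSimplicialComplex V) : Ideal (MvPolynomial V K) :=
  Ideal.span {m | ∃ F ∈ facets Δ, m = sqfreeMonomial K F}

/-- The closed neighborhood ideal `NI(G)`. -/
def closedNbhdIdeal [Fintype V] [DecidableEq V] (G : SimpleGraph V) [DecidableRel G.Adj] :
    Ideal (MvPolynomial V K) :=
  facetIdeal K (closedNbhdComplex G)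

variable {K}

/-- The `k`-th squarefree power `I^{[k]}`: the ideal generated by the squarefree monomials that
belong to `I ^ k`. -/
def squarefreePower (I : Ideal (MvPolynomial V K)) (k : ℕ) : Ideal (MvPolynomial V K) :=
  Ideal.span {m | ∃ A : Finset V, m = sqfreeMonomial K A ∧ m ∈ I ^ k}

/-- The ideal `I_⟨j⟩` generated by the homogeneous elements of degree `j` of `I`. -/
def degreeComponent (I : Ideal (MvPolynomial V K)) (j : ℕ) : Ideal (MvPolynomial V K) :=
  Ideal.span {f | f ∈ I ∧ f.IsHomogeneous j}

/-! ### Minimal graded free resolutions, Betti numbers, linear resolutions -/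

/-- `f` is homogeneous of degree `d ∈ ℤ` (in particular `f = 0` if `d < 0`). -/
def IsHomogeneousOfDegree (f : MvPolynomial V K) (d : ℤ) : Prop :=
  ∀ m ∈ f.support, (m.degree : ℤ) = d

/-- A minimal graded free resolution
`⋯ ⟶ F₂ ⟶ F₁ ⟶ F₀ ⟶ I ⟶ 0` of the homogeneous ideal `I` of `S`, by finitely generated graded
free modules `F i = ⨁_b S(-shift i b)` with `b` ranging over `Fin (rank i)`, all maps being
homogeneous of degree `0`. The map `F (i + 1) ⟶ F i` is given by the matrix `diff i`, the
augmentation `F 0 ⟶ I` sends the `b`-th basis vector to `gen b`. Minimality means that the entries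
of the matrices lie in the ideal generated by the variables. -/
structure MinimalGradedFreeResolution (I : Ideal (MvPolynomial V K)) where
  rank : ℕ → ℕ
  shift : (i : ℕ) → Fin (rank i) → ℤ
  gen : Fin (rank 0) → MvPolynomial V K
  diff : (i : ℕ) → Matrix (Fin (rank i)) (Fin (rank (i + 1))) (MvPolynomial V K)
  gen_homogeneous : ∀ b, IsHomogeneousOfDegree (gen b) (shift 0 b)
  diff_homogeneous : ∀ i a b,
    IsHomogeneousOfDegree (diff i a b) (shift (i + 1) b - shift i a)
  span_gen : Ideal.span (Set.range gen) = I
  exact_gen : Function.Exact (diff 0).mulVecLin (Fintype.linearCombination (MvPolynomial V K) gen)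
  exact_diff : ∀ i, Function.Exact (diff (i + 1)).mulVecLin (diff i).mulVecLin
  minimal : ∀ i a b, diff i a b ∈ Ideal.span (Set.range (MvPolynomial.X : V → MvPolynomial V K))

/-- The graded Betti number `β_{i,j}`: the number of summands `S(-j)` of `F i`. -/
def MinimalGradedFreeResolution.betti {I : Ideal (MvPolynomial V K)}
    (F : MinimalGradedFreeResolution I) (i : ℕ) (j : ℤ) : ℕ :=
  (Finset.univ.filter (fun b => F.shift i b = j)).card

/-- `I` has a `d`-linear resolution: `β_{i,j}(I) = 0` whenever `j ≠ i + d`. -/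
def HasDLinearResolution (I : Ideal (MvPolynomial V K)) (d : ℕ) : Prop :=
  ∃ F : MinimalGradedFreeResolution I, ∀ (i : ℕ) (j : ℤ), j ≠ i + d → F.betti i j = 0

/-- `I` has a linear resolution. -/
def HasLinearResolution (I : Ideal (MvPolynomial V K)) : Prop :=
  ∃ d, HasDLinearResolution I d

/-- `I` is componentwise linear: `I_⟨j⟩` has a linear resolution for all `j`. -/
def IsComponentwiseLinear (I : Ideal (MvPolynomial V K)) : Prop :=
  ∀ j, HasLinearResolution (degreeComponent I j)

end Ideals

end CNI

end

/-! If the degree-j component of a monomial ideal has a linear resolution, then the squarefree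
monomials of degree j in the ideal that are supported in a given vertex set W are connected by
exchanges of one variable, because the first syzygies are linear (`exists_linear_relation`). The
proof finds j and W for which they are disconnected.

Put A = N[r], B = N[t] and W = A ∪ B ∪ ⋃ Y. Every ν-matching inside W contains A or B
(`Fork.mem_or_mem`), and never both, as they share s. Among those through A, and among those through
B, let N and M cover the fewest vertices; by symmetry M covers no more than N, and j is the number
of vertices covered by N. A j-subset of W containing a matching through A is exactly the support of
a smallest one, and an exchange of one vertex never leads from it to a set containing a matching
through B (`Fork.not_covered`). So the support of N and the support of M, padded to size j, are not
connected.

Both combinatorial facts come from one count (`card_lt_card_of_covered`). In the tree rooted at s,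
closed neighborhoods are subtrees; disjoint subtrees covered by a nonempty disjoint family, none
lying inside a single member of it, are fewer than that family. For `Fork.not_covered` the count is
made separately inside and outside the branch at t. -/

noncomputable section

namespace CNI

/-! ### Subtrees of a rooted tree and the counting lemma -/

section Rooted

variable {V : Type*}

/-- A parent function `par` with a height function decreasing towards the root `s`. -/
structure IsRooting (par : V → V) (h : V → ℕ) (s : V) : Prop where
  par_root : par s = s
  lt_height : ∀ y, y ≠ s → h (par y) < h y

/-- `F` is a connected set of vertices of the rooted forest with topmost vertex `x`. -/
def IsSubtree (par : V → V) (h : V → ℕ) (F : Finset V) (x : V) : Prop :=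
  x ∈ F ∧ ∀ y ∈ F, y ≠ x → par y ∈ F ∧ h (par y) < h y

variable {par : V → V} {h : V → ℕ} {s : V}

theorem IsSubtree.height_le {F : Finset V} {x : V} (hF : IsSubtree par h F x) :
    ∀ y ∈ F, y ≠ x → h x < h y := by
  obtain ⟨z, hz, hmin⟩ := F.exists_min_image h ⟨x, hF.1⟩
  have hzx : z = x := by
    by_contra hne
    exact absurd (hmin _ (hF.2 z hz hne).1) (not_le.2 (hF.2 z hz hne).2)
  subst hzx
  intro y hy hne
  exact (hmin _ (hF.2 y hy hne).1).trans_lt (hF.2 y hy hne).2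

theorem isSubtree_singleton (x : V) : IsSubtree par h {x} x :=
  ⟨by simp, fun y hy hne => absurd (by simpa using hy) hne⟩

theorem IsSubtree.union [DecidableEq V] {F E : Finset V} {x : V} (hF : IsSubtree par h F x)
    (hE : IsSubtree par h E x) : IsSubtree par h (F ∪ E) x := by
  refine ⟨Finset.mem_union_left _ hF.1, fun y hy hne => ?_⟩
  rcases Finset.mem_union.1 hy with hy | hy
  · exact ⟨Finset.mem_union_left _ (hF.2 y hy hne).1, (hF.2 y hy hne).2⟩
  · exact ⟨Finset.mem_union_right _ (hE.2 y hy hne).1, (hE.2 y hy hne).2⟩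

/-- If two subtrees meet, then one of the two top vertices lies in the other subtree. -/
theorem IsSubtree.top_mem [DecidableEq V] {F E : Finset V} {x y : V} (hF : IsSubtree par h F x)
    (hE : IsSubtree par h E y) (hFE : ¬ Disjoint F E) : x ∈ E ∨ y ∈ F := by
  have hne : (F ∩ E).Nonempty := Finset.not_disjoint_iff_nonempty_inter.1 hFE
  obtain ⟨z, hz, hmin⟩ := (F ∩ E).exists_min_image h hne
  obtain ⟨hzF, hzE⟩ := Finset.mem_inter.1 hz
  by_cases hx : z = x
  · exact Or.inl (hx ▸ hzE)
  by_cases hy : z = y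
  · exact Or.inr (hy ▸ hzF)
  exact absurd (hmin _ (Finset.mem_inter.2 ⟨(hF.2 z hzF hx).1, (hE.2 z hzE hy).1⟩))
    (not_le.2 (hF.2 z hzF hx).2)

theorem eq_of_mem_of_mem {P : Finset (Finset V)}
    (hP : ∀ F ∈ P, ∀ E ∈ P, F ≠ E → Disjoint F E) {F E : Finset V} (hF : F ∈ P) (hE : E ∈ P)
    {y : V} (hyF : y ∈ F) (hyE : y ∈ E) : F = E := by
  by_contra hne
  exact Finset.disjoint_left.1 (hP F hF E hE hne) hyF hyE

/-- Let `P` and `Q` be two families of disjoint subtrees, `Q` nonempty. If every member of `P` is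
covered by `Q` but by no single member of `Q`, then `P` has fewer members than `Q`. -/
theorem card_lt_card_of_covered [DecidableEq V] {P Q : Finset (Finset V)}
    (hP : ∀ F ∈ P, ∃ x, IsSubtree par h F x) (hQ : ∀ F ∈ Q, ∃ x, IsSubtree par h F x)
    (dP : ∀ F ∈ P, ∀ E ∈ P, F ≠ E → Disjoint F E) (dQ : ∀ F ∈ Q, ∀ E ∈ Q, F ≠ E → Disjoint F E)
    (hne : Q.Nonempty) (hcov : ∀ F ∈ P, ∀ y ∈ F, ∃ E ∈ Q, y ∈ E)
    (hnot : ∀ F ∈ P, ∀ E ∈ Q, ¬ F ⊆ E) : P.card < Q.card := by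
  obtain ⟨E', hE'⟩ := hne
  obtain ⟨v, -⟩ := hQ E' hE'
  have : Nonempty V := ⟨v⟩
  choose! p hp using hP
  choose! q hq using hQ
  -- `F` leaves the member of `Q` containing its top, so it meets a second member `E`, which avoids
  -- that top. Hence the top of `E` lies in `F`.
  have key : ∀ F ∈ P, ∃ E ∈ Q, q E ∈ F ∧ p F ∉ E := by
    intro F hF
    obtain ⟨E₀, hE₀, hpE₀⟩ := hcov F hF _ (hp F hF).1
    obtain ⟨y, hyF, hyE₀⟩ := Finset.not_subset.1 (hnot F hF E₀ hE₀)
    obtain ⟨E, hE, hyE⟩ := hcov F hF y hyF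
    have hpE : p F ∉ E := fun hpE => hyE₀ (eq_of_mem_of_mem dQ hE hE₀ hpE hpE₀ ▸ hyE)
    refine ⟨E, hE, ?_, hpE⟩
    exact ((hp F hF).top_mem (hq E hE) (Finset.not_disjoint_iff.2 ⟨y, hyF, hyE⟩)).resolve_left hpE
  choose! f hfQ hfF hfp using key
  -- `f` is injective, since `q (f F) ∈ F` and `P` is disjoint. It misses `E₁`, whose top is nearest
  -- to the root: the top of `f F` is strictly below `p F`, which lies in a member whose top is at
  -- least as high as `p F`.
  obtain ⟨E₁, hE₁, hmin⟩ := Q.exists_min_image (fun E => h (q E)) ⟨E', hE'⟩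
  have hmaps : ∀ F ∈ P, f F ∈ Q.erase E₁ := by
    intro F hF
    refine Finset.mem_erase.2 ⟨fun hfE => ?_, hfQ F hF⟩
    obtain ⟨E₀, hE₀, hpE₀⟩ := hcov F hF _ (hp F hF).1
    have hneq : q (f F) ≠ p F := fun he => hfp F hF (he ▸ (hq _ (hfQ F hF)).1)
    have h1 : h (p F) < h (q (f F)) := (hp F hF).height_le _ (hfF F hF) hneq
    have h2 : h (q E₀) ≤ h (p F) := by
      by_cases he : p F = q E₀
      · rw [he]
      · exact ((hq E₀ hE₀).height_le _ hpE₀ he).le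
    have h3 := hmin E₀ hE₀
    rw [hfE] at h1
    omega
  have hinj : Set.InjOn f P := by
    intro F hF E hE hfe
    exact eq_of_mem_of_mem dP hF hE (hfF F hF) (hfe ▸ hfF E hE)
  have h1 : P.card ≤ (Q.erase E₁).card := Finset.card_le_card_of_injOn f hmaps hinj
  exact h1.trans_lt (Finset.card_erase_lt_of_mem hE₁)

/-- The descendants of `t`. -/
def branch (par : V → V) (t : V) : Set V := {y | ∃ n : ℕ, par^[n] y = t}

theorem mem_branch_self (t : V) : t ∈ branch par t := ⟨0, rfl⟩

theorem par_mem_branch_iff {t y : V} (hy : y ≠ t) : par y ∈ branch par t ↔ y ∈ branch par t := by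
  constructor
  · rintro ⟨n, hn⟩
    exact ⟨n + 1, by simpa using hn⟩
  · rintro ⟨n, hn⟩
    cases n with
    | zero => exact absurd hn hy
    | succ n => exact ⟨n, by simpa using hn⟩

theorem IsRooting.root_notMem_branch (hr : IsRooting par h s) {t : V} (ht : t ≠ s) :
    s ∉ branch par t := by
  rintro ⟨n, hn⟩
  rw [Function.iterate_fixed hr.par_root] at hn
  exact ht hn.symm

/-- A subtree avoiding the parent of `t` lies inside or outside of the branch of `t`. -/
theorem IsSubtree.mem_branch_iff {F : Finset V} {x t : V} (hF : IsSubtree par h F x)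
    (hs : par t ∉ F) : ∀ y ∈ F, (y ∈ branch par t ↔ x ∈ branch par t) := by
  have : ∀ n, ∀ y ∈ F, h y = n → (y ∈ branch par t ↔ x ∈ branch par t) := by
    intro n
    induction n using Nat.strong_induction_on with
    | _ n ih =>
      intro y hy hn
      by_cases hyx : y = x
      · rw [hyx]
      have hyt : y ≠ t := by
        rintro rfl
        exact hs (hF.2 y hy hyx).1
      rw [← par_mem_branch_iff hyt]
      exact ih _ (hn ▸ (hF.2 y hy hyx).2) _ (hF.2 y hy hyx).1 rfl
  exact fun y hy => this _ y hy rfl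

/-- A tree can be rooted at any vertex. -/
theorem exists_isRooting {T : SimpleGraph V} (hT : T.IsTree) (s : V) :
    ∃ (par : V → V) (h : V → ℕ), IsRooting par h s ∧ (∀ y, y ≠ s → T.Adj y (par y)) ∧
      ∀ x y, T.Adj x y → (x ≠ s ∧ par x = y) ∨ (y ≠ s ∧ par y = x) := by
  choose p hp _ using fun v => hT.existsUnique_path v s
  refine ⟨fun v => (p v).snd, fun v => (p v).length, ⟨?_, ?_⟩, ?_, ?_⟩
  · have := SimpleGraph.Walk.isPath_iff_nil.1 (hp s)
    simp [this.eq_nil]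
  · intro y hy
    have hn : ¬ (p y).Nil := SimpleGraph.Walk.not_nil_of_ne hy
    have : (p (p y).snd) = (p y).tail :=
      (hT.existsUnique_path _ s).unique (hp _) (hp y).tail
    rw [this, ← SimpleGraph.Walk.length_tail_add_one hn]
    omega
  · intro y hy
    exact SimpleGraph.Walk.adj_snd (SimpleGraph.Walk.not_nil_of_ne hy)
  · have key : ∀ x y, T.Adj x y → y ∈ (p x).support → x ≠ s ∧ (p x).snd = y := by
      intro x y hxy hmem
      refine ⟨?_, (hT.isAcyclic.eq_snd_of_adj_start (hp x) hxy hmem).symm⟩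
      rintro rfl
      rw [(SimpleGraph.Walk.isPath_iff_nil.1 (hp x)).eq_nil] at hmem
      exact hxy.ne' (by simpa using hmem)
    intro x y hxy
    by_cases hmem : y ∈ (p x).support
    · exact Or.inl (key x y hxy hmem)
    · refine Or.inr (key y x hxy.symm ?_)
      have hc : ((p x).cons hxy.symm).IsPath := (hp x).cons hmem
      rw [(hT.existsUnique_path y s).unique (hp y) hc]
      simp

end Rooted

/-! ### Matchings around two facets that meet in the root -/

section Fork

variable {V : Type*} {Δ : PreAbstractSimplicialComplex V}

theorem eq_of_subset_of_mem_facets {F E : Finset V} (hF : F ∈ facets Δ) (hE : E ∈ facets Δ)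
    (h : F ⊆ E) : F = E :=
  h.antisymm (hF.2 hE.1 h)

theorem IsMatching.eq_of_mem {k : ℕ} {M : Finset (Finset V)} (hM : IsMatching Δ k M)
    {F E : Finset V} (hF : F ∈ M) (hE : E ∈ M) {y : V} (hyF : y ∈ F) (hyE : y ∈ E) : F = E :=
  eq_of_mem_of_mem hM.2.1 hF hE hyF hyE

variable [DecidableEq V]

/-- The set of vertices covered by a family of finite sets. -/
def support (M : Finset (Finset V)) : Finset V := M.biUnion id

theorem mem_support {M : Finset (Finset V)} {y : V} : y ∈ support M ↔ ∃ F ∈ M, y ∈ F := by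
  simp [support]

theorem subset_support {M : Finset (Finset V)} {F : Finset V} (hF : F ∈ M) : F ⊆ support M :=
  fun _ hy => mem_support.2 ⟨F, hF, hy⟩

theorem IsMatching.swap {k : ℕ} {M P Q : Finset (Finset V)} (hM : IsMatching Δ k M)
    (hQ : Q ⊆ M) (hP : ∀ F ∈ P, F ∈ facets Δ) (dP : ∀ F ∈ P, ∀ E ∈ P, F ≠ E → Disjoint F E)
    (hcard : P.card = Q.card) (hPM : ∀ F ∈ P, ∀ E ∈ M, E ∉ Q → Disjoint F E) :
    IsMatching Δ k ((M \ Q) ∪ P) := by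
  refine ⟨?_, ?_, ?_⟩
  · intro F hF
    rcases Finset.mem_union.1 hF with hF | hF
    · exact hM.1 F (Finset.mem_sdiff.1 hF).1
    · exact hP F hF
  · intro F hF E hE hne
    rcases Finset.mem_union.1 hF with hF | hF <;> rcases Finset.mem_union.1 hE with hE | hE
    · exact hM.2.1 F (Finset.mem_sdiff.1 hF).1 E (Finset.mem_sdiff.1 hE).1 hne
    · exact (hPM E hE F (Finset.mem_sdiff.1 hF).1 (Finset.mem_sdiff.1 hF).2).symm
    · exact hPM F hF E (Finset.mem_sdiff.1 hE).1 (Finset.mem_sdiff.1 hE).2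
    · exact dP F hF E hE hne
  · have hd : Disjoint (M \ Q) P := by
      refine Finset.disjoint_left.2 fun F hF hFP => ?_
      obtain ⟨hFM, hFQ⟩ := Finset.mem_sdiff.1 hF
      have h1 := hPM F hFP F hFM hFQ
      have h2 : F.Nonempty := (Δ.isRelLowerSet_faces (hM.1 F hFM).1).1
      rw [disjoint_self] at h1
      exact h2.ne_empty h1
    rw [Finset.card_union_of_disjoint hd, Finset.card_sdiff_of_subset hQ, hcard, hM.2.2]
    have := Finset.card_le_card hQ
    rw [hM.2.2] at this
    omega

/-- Facets do not contain one another, so if the matchings differed, the counting lemma for `M \ N`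
and `N \ M` would contradict their equal size. -/
theorem IsMatching.eq_of_support_subset {par : V → V} {h : V → ℕ}
    (hsub : ∀ F ∈ facets Δ, ∃ x, IsSubtree par h F x) {k : ℕ} {M N : Finset (Finset V)}
    (hM : IsMatching Δ k M) (hN : IsMatching Δ k N) (hMN : ∀ F ∈ M, F ⊆ support N) : M = N := by
  have hc : (M \ N).card = (N \ M).card :=
    Finset.card_sdiff_comm (hM.2.2.trans hN.2.2.symm)
  rcases (N \ M).eq_empty_or_nonempty with he | hne
  · rw [he, Finset.card_empty, Finset.card_eq_zero] at hc
    exact (Finset.sdiff_eq_empty_iff_subset.1 hc).antisymm (Finset.sdiff_eq_empty_iff_subset.1 he)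
  · refine absurd hc (card_lt_card_of_covered (par := par) (h := h) (P := M \ N) (Q := N \ M)
      ?_ ?_ ?_ ?_ hne ?_ ?_).ne
    · exact fun F hF => hsub F (hM.1 F (Finset.mem_sdiff.1 hF).1)
    · exact fun F hF => hsub F (hN.1 F (Finset.mem_sdiff.1 hF).1)
    · exact fun F hF E hE => hM.2.1 F (Finset.mem_sdiff.1 hF).1 E (Finset.mem_sdiff.1 hE).1
    · exact fun F hF E hE => hN.2.1 F (Finset.mem_sdiff.1 hF).1 E (Finset.mem_sdiff.1 hE).1
    · intro F hF y hy
      obtain ⟨hFM, hFN⟩ := Finset.mem_sdiff.1 hF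
      obtain ⟨E, hE, hyE⟩ := mem_support.1 (hMN F hFM hy)
      exact ⟨E, Finset.mem_sdiff.2 ⟨hE, fun hEM => hFN (hM.eq_of_mem hFM hEM hy hyE ▸ hE)⟩, hyE⟩
    · intro F hF E hE hFE
      obtain ⟨hFM, hFN⟩ := Finset.mem_sdiff.1 hF
      obtain ⟨hEN, hEM⟩ := Finset.mem_sdiff.1 hE
      exact hFN (eq_of_subset_of_mem_facets (hM.1 F hFM) (hN.1 E hEN) hFE ▸ hEN)

/-- The facets of `Δ` are subtrees of a rooted tree, and `A`, `B` are two facets of at least three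
vertices meeting exactly in the root `s`, such that no other facet is contained in `A ∪ B`.
Moreover, `C` is a union of branches containing `B \ {s}` and disjoint from `A`. -/
structure Fork (par : V → V) (h : V → ℕ) (Δ : PreAbstractSimplicialComplex V) (s : V)
    (A B : Finset V) (C : Set V) : Prop where
  subtree : ∀ F ∈ facets Δ, ∃ x, IsSubtree par h F x
  two_le : ∀ F ∈ facets Δ, 2 ≤ F.card
  left_mem : A ∈ facets Δ
  right_mem : B ∈ facets Δ
  left_subtree : IsSubtree par h A s
  right_subtree : IsSubtree par h B s
  three_le : 3 ≤ B.card
  inter : ∀ y, y ∈ A → y ∈ B → y = s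
  eq_or_eq : ∀ F ∈ facets Δ, F ⊆ A ∪ B → F = A ∨ F = B
  left_branch : ∀ y ∈ A, y ∉ C
  right_branch : ∀ y ∈ B, y ≠ s → y ∈ C
  mem_branch : ∀ F ∈ facets Δ, s ∉ F → ∀ y ∈ F, y ∈ C → ∀ z ∈ F, z ∈ C

variable {par : V → V} {h : V → ℕ} {s : V} {A B : Finset V} {C : Set V}

theorem Fork.ne (hf : Fork par h Δ s A B C) : A ≠ B := by
  rintro rfl
  have : A ⊆ {s} := fun y hy => Finset.mem_singleton.2 (hf.inter y hy hy)
  have h1 := Finset.card_le_card this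
  have h2 := hf.three_le
  simp at h1
  omega

variable {k : ℕ} {Y M : Finset (Finset V)}

/-- A `(k + 1)`-matching inside `A ∪ B ∪ ⋃ Y` contains `A` or `B`, if `Y` is a `k`-matching. -/
theorem Fork.mem_or_mem (hf : Fork par h Δ s A B C) (hY : IsMatching Δ k Y)
    (hd : ∀ F ∈ Y, Disjoint F (A ∪ B)) (hM : IsMatching Δ (k + 1) M)
    (hW : ∀ F ∈ M, F ⊆ A ∪ B ∪ support Y) : A ∈ M ∨ B ∈ M := by
  by_contra hcon
  -- `A ∪ B` counts as a single subtree with top `s`. With it, `Y` becomes a disjoint family of k +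
  -- 1 subtrees covering `M`; if `M` avoids `A` and `B`, the counting lemma contradicts the equality
  -- of sizes.
  have hRY : A ∪ B ∉ Y \ M := by
    intro hR
    have h1 := hd _ (Finset.mem_sdiff.1 hR).1
    rw [disjoint_self] at h1
    have h2 : s ∈ A ∪ B := Finset.mem_union_left _ hf.left_subtree.1
    rw [h1] at h2
    simp at h2
  have hc : (M \ Y).card = (insert (A ∪ B) (Y \ M)).card := by
    rw [Finset.card_insert_of_notMem hRY]
    have h1 := Finset.card_sdiff_add_card_inter M Y
    have h2 := Finset.card_sdiff_add_card_inter Y M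
    rw [Finset.inter_comm, hY.2.2] at h2
    rw [hM.2.2] at h1
    omega
  refine absurd hc (card_lt_card_of_covered (par := par) (h := h) ?_ ?_ ?_ ?_
    (Finset.insert_nonempty _ _) ?_ ?_).ne
  · exact fun F hF => hf.subtree F (hM.1 F (Finset.mem_sdiff.1 hF).1)
  · intro F hF
    rcases Finset.mem_insert.1 hF with rfl | hF
    · exact ⟨s, hf.left_subtree.union hf.right_subtree⟩
    · exact hf.subtree F (hY.1 F (Finset.mem_sdiff.1 hF).1)
  · exact fun F hF E hE => hM.2.1 F (Finset.mem_sdiff.1 hF).1 E (Finset.mem_sdiff.1 hE).1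
  · intro F hF E hE hne
    rcases Finset.mem_insert.1 hF with rfl | hF <;> rcases Finset.mem_insert.1 hE with rfl | hE
    · exact absurd rfl hne
    · exact (hd E (Finset.mem_sdiff.1 hE).1).symm
    · exact hd F (Finset.mem_sdiff.1 hF).1
    · exact hY.2.1 F (Finset.mem_sdiff.1 hF).1 E (Finset.mem_sdiff.1 hE).1 hne
  · intro F hF y hy
    obtain ⟨hFM, hFY⟩ := Finset.mem_sdiff.1 hF
    rcases Finset.mem_union.1 (hW F hFM hy) with hyR | hyY
    · exact ⟨_, Finset.mem_insert_self _ _, hyR⟩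
    · obtain ⟨E, hE, hyE⟩ := mem_support.1 hyY
      exact ⟨E, Finset.mem_insert_of_mem (Finset.mem_sdiff.2
        ⟨hE, fun hEM => hFY (hM.eq_of_mem hFM hEM hy hyE ▸ hE)⟩), hyE⟩
  · intro F hF E hE hFE
    obtain ⟨hFM, hFY⟩ := Finset.mem_sdiff.1 hF
    rcases Finset.mem_insert.1 hE with rfl | hE
    · rcases hf.eq_or_eq F (hM.1 F hFM) hFE with rfl | rfl
      · exact hcon (Or.inl hFM)
      · exact hcon (Or.inr hFM)
    · obtain ⟨hEY, -⟩ := Finset.mem_sdiff.1 hE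
      exact hFY (eq_of_subset_of_mem_facets (hM.1 F hFM) (hY.1 E hEY) hFE ▸ hEY)

/-- A matching through `B` is not covered by a smallest matching through `A` and one further
vertex. -/
theorem Fork.not_covered (hf : Fork par h Δ s A B C) (hY : IsMatching Δ k Y)
    (hd : ∀ F ∈ Y, Disjoint F (A ∪ B)) {N : Finset (Finset V)}
    (hN : IsMatching Δ (k + 1) N) (hAN : A ∈ N) (hNW : ∀ F ∈ N, F ⊆ A ∪ B ∪ support Y)
    (hM : IsMatching Δ (k + 1) M) (hBM : B ∈ M) (hMW : ∀ F ∈ M, F ⊆ A ∪ B ∪ support Y)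
    (hmin : ∀ N', IsMatching Δ (k + 1) N' → A ∈ N' → (∀ F ∈ N', F ⊆ A ∪ B ∪ support Y) →
      (support N).card ≤ (support N').card)
    (x : V) (hcov : ∀ F ∈ M, F ⊆ insert x (support N)) : False := by
  classical
  have hsA := hf.left_subtree.1
  have hsB := hf.right_subtree.1
  have hBN : B ∉ N := fun hB => hf.ne (hN.eq_of_mem hAN hB hsA hsB)
  have hAM : A ∉ M := fun hA => hf.ne (hM.eq_of_mem hA hBM hsA hsB)
  have hx : x ∉ support N := by
    intro hx
    rw [Finset.insert_eq_of_mem hx] at hcov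
    exact hBN (hM.eq_of_support_subset hf.subtree hN hcov ▸ hBM)
  have hxs : x ≠ s := by
    rintro rfl
    exact hx (subset_support hAN hsA)
  -- The index 2 marks facets meeting `C`, hence inside it; the index 1 marks those outside `C`.
  -- Removing `B` from `M \ N` leaves exactly one facet fewer than in `N \ M`.
  let p : Finset V → Prop := fun F => ∃ y ∈ F, y ∈ C
  obtain ⟨P₁, hP₁⟩ : ∃ P₁, P₁ = ((M \ N).erase B).filter (fun F => ¬ p F) := ⟨_, rfl⟩
  obtain ⟨P₂, hP₂⟩ : ∃ P₂, P₂ = ((M \ N).erase B).filter p := ⟨_, rfl⟩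
  obtain ⟨Q₁, hQ₁⟩ : ∃ Q₁, Q₁ = (N \ M).filter (fun F => ¬ p F) := ⟨_, rfl⟩
  obtain ⟨Q₂, hQ₂⟩ : ∃ Q₂, Q₂ = (N \ M).filter p := ⟨_, rfl⟩
  have hcard : P₁.card + P₂.card + 1 = Q₁.card + Q₂.card := by
    have h1 : (M \ N).card = (N \ M).card := Finset.card_sdiff_comm (hM.2.2.trans hN.2.2.symm)
    have h2 := Finset.card_erase_add_one (Finset.mem_sdiff.2 ⟨hBM, hBN⟩)
    have h3 := Finset.card_filter_add_card_filter_not (s := (M \ N).erase B) p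
    have h4 := Finset.card_filter_add_card_filter_not (s := N \ M) p
    rw [← hP₁, ← hP₂] at h3
    rw [← hQ₁, ← hQ₂] at h4
    omega
  have memP₁ : ∀ F ∈ P₁, F ∈ M ∧ F ∉ N ∧ F ≠ B ∧ ∀ y ∈ F, y ∉ C := by
    intro F hF
    simp only [hP₁, Finset.mem_filter, Finset.mem_erase, Finset.mem_sdiff, p] at hF
    exact ⟨hF.1.2.1, hF.1.2.2, hF.1.1, fun y hy hyC => hF.2 ⟨y, hy, hyC⟩⟩
  have memP₂ : ∀ F ∈ P₂, F ∈ M ∧ F ∉ N ∧ F ≠ B ∧ ∀ y ∈ F, y ∈ C := by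
    intro F hF
    simp only [hP₂, Finset.mem_filter, Finset.mem_erase, Finset.mem_sdiff, p] at hF
    obtain ⟨y, hy, hyC⟩ := hF.2
    exact ⟨hF.1.2.1, hF.1.2.2, hF.1.1, hf.mem_branch F (hM.1 F hF.1.2.1)
      (fun hs => hF.1.1 (hM.eq_of_mem hF.1.2.1 hBM hs hsB)) y hy hyC⟩
  have memQ₁ : ∀ F ∈ Q₁, F ∈ N ∧ F ∉ M := by
    intro F hF
    simp only [hQ₁, Finset.mem_filter, Finset.mem_sdiff] at hF
    exact hF.1
  have memQ₂ : ∀ F ∈ Q₂, F ∈ N ∧ F ∉ M ∧ F ≠ A ∧ ∀ y ∈ F, y ∈ C := by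
    intro F hF
    simp only [hQ₂, Finset.mem_filter, Finset.mem_sdiff, p] at hF
    obtain ⟨y, hy, hyC⟩ := hF.2
    have hFA : F ≠ A := by
      rintro rfl
      exact hf.left_branch y hy hyC
    exact ⟨hF.1.1, hF.1.2, hFA, hf.mem_branch F (hN.1 F hF.1.1)
      (fun hs => hFA (hN.eq_of_mem hF.1.1 hAN hs hsA)) y hy hyC⟩
  have hAQ₁ : A ∈ Q₁ := by
    simp only [hQ₁, Finset.mem_filter, Finset.mem_sdiff, p]
    exact ⟨⟨hAN, hAM⟩, fun ⟨y, hy, hyC⟩ => hf.left_branch y hy hyC⟩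
  have toQ : ∀ y, y ∈ support N → ∀ F ∈ M, F ∉ N → y ∈ F →
      (y ∈ C → ∃ E ∈ Q₂, y ∈ E) ∧ (y ∉ C → ∃ E ∈ Q₁, y ∈ E) := by
    intro y hy F hF hFN hyF
    obtain ⟨E, hE, hyE⟩ := mem_support.1 hy
    have hEM : E ∉ M := fun hEM => hFN (hM.eq_of_mem hF hEM hyF hyE ▸ hE)
    refine ⟨fun hyC => ⟨E, ?_, hyE⟩, fun hyC => ⟨E, ?_, hyE⟩⟩
    · rw [hQ₂]
      exact Finset.mem_filter.2 ⟨Finset.mem_sdiff.2 ⟨hE, hEM⟩, y, hyE, hyC⟩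
    · by_contra hEQ
      have : E ∈ Q₂ := by
        rw [hQ₂]
        rw [hQ₁] at hEQ
        simp only [Finset.mem_filter, Finset.mem_sdiff, hE, hEM] at hEQ ⊢
        simpa using hEQ
      exact hyC ((memQ₂ E this).2.2.2 y hyE)
  have hBQ : ∀ y ∈ B, y ≠ s → y ≠ x → ∃ E ∈ Q₂, y ∈ E := by
    intro y hy hys hyx
    exact (toQ y ((Finset.mem_insert.1 (hcov B hBM hy)).resolve_left hyx) B hBM hBN hy).1
      (hf.right_branch y hy hys)
  -- `B` has a vertex other than `s` and `x`; it is covered by `N`, inside `C`.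
  have hQ₂ne : Q₂.Nonempty := by
    have h1 : 0 < ((B.erase s).erase x).card := by
      have h2 := Finset.pred_card_le_card_erase (s := B) (a := s)
      have h3 := Finset.pred_card_le_card_erase (s := B.erase s) (a := x)
      have h4 := hf.three_le
      omega
    obtain ⟨y, hy⟩ := Finset.card_pos.1 h1
    simp only [Finset.mem_erase] at hy
    obtain ⟨E, hE, -⟩ := hBQ y hy.2.2 hy.2.1 hy.1
    exact ⟨E, hE⟩
  have lt_of_covered : ∀ P Q : Finset (Finset V), (∀ F ∈ P, F ∈ M ∧ F ∉ N) →
      (∀ E ∈ Q, E ∈ N ∧ E ∉ M) → Q.Nonempty → (∀ F ∈ P, ∀ y ∈ F, ∃ E ∈ Q, y ∈ E) →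
      P.card < Q.card := by
    intro P Q hP hQ hne hcov
    refine card_lt_card_of_covered (par := par) (h := h) (fun F hF => hf.subtree F (hM.1 F (hP F hF).1))
      (fun F hF => hf.subtree F (hN.1 F (hQ F hF).1))
      (fun F hF E hE => hM.2.1 F (hP F hF).1 E (hP E hE).1)
      (fun F hF E hE => hN.2.1 F (hQ F hF).1 E (hQ E hE).1) hne hcov fun F hF E hE hFE => ?_
    exact (hP F hF).2 (eq_of_subset_of_mem_facets (hM.1 F (hP F hF).1) (hN.1 E (hQ E hE).1) hFE ▸
      (hQ E hE).1)
  -- The singleton `{x}` joins `Q` as one more subtree. It contains no facet, since facets have at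
  -- least two vertices.
  have le_of_covered : ∀ P Q : Finset (Finset V), (∀ F ∈ P, F ∈ M ∧ F ∉ N) →
      (∀ E ∈ Q, E ∈ N ∧ E ∉ M) → (∀ F ∈ P, ∀ y ∈ F, y = x ∨ ∃ E ∈ Q, y ∈ E) →
      P.card ≤ Q.card := by
    intro P Q hP hQ hcov
    have hxQ : ∀ E ∈ Q, x ∉ E := fun E hE hxE => hx (subset_support (hQ E hE).1 hxE)
    have h1 : P.card < (insert {x} Q).card := by
      refine card_lt_card_of_covered (par := par) (h := h)
        (fun F hF => hf.subtree F (hM.1 F (hP F hF).1)) ?_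
        (fun F hF E hE => hM.2.1 F (hP F hF).1 E (hP E hE).1) ?_ (Finset.insert_nonempty _ _) ?_ ?_
      · intro F hF
        rcases Finset.mem_insert.1 hF with rfl | hF
        · exact ⟨x, isSubtree_singleton x⟩
        · exact hf.subtree F (hN.1 F (hQ F hF).1)
      · intro F hF E hE hne
        rcases Finset.mem_insert.1 hF with rfl | hF <;>
          rcases Finset.mem_insert.1 hE with rfl | hE
        · exact absurd rfl hne
        · exact Finset.disjoint_singleton_left.2 (hxQ E hE)
        · exact Finset.disjoint_singleton_right.2 (hxQ F hF)
        · exact hN.2.1 F (hQ F hF).1 E (hQ E hE).1 hne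
      · intro F hF y hy
        rcases hcov F hF y hy with rfl | ⟨E, hE, hyE⟩
        · exact ⟨_, Finset.mem_insert_self _ _, Finset.mem_singleton_self _⟩
        · exact ⟨E, Finset.mem_insert_of_mem hE, hyE⟩
      · intro F hF E hE hFE
        rcases Finset.mem_insert.1 hE with rfl | hE
        · have h2 := Finset.card_le_card hFE
          have h3 := hf.two_le F (hM.1 F (hP F hF).1)
          simp at h2
          omega
        · exact (hP F hF).2 (eq_of_subset_of_mem_facets (hM.1 F (hP F hF).1)
            (hN.1 E (hQ E hE).1) hFE ▸ (hQ E hE).1)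
    have h2 := Finset.card_insert_le {x} Q
    omega
  have hP₁' : ∀ F ∈ P₁, F ∈ M ∧ F ∉ N := fun F hF => ⟨(memP₁ F hF).1, (memP₁ F hF).2.1⟩
  have hP₂' : ∀ F ∈ P₂, F ∈ M ∧ F ∉ N := fun F hF => ⟨(memP₂ F hF).1, (memP₂ F hF).2.1⟩
  have hQ₂' : ∀ F ∈ Q₂, F ∈ N ∧ F ∉ M := fun F hF => ⟨(memQ₂ F hF).1, (memQ₂ F hF).2.1⟩
  have cov₁ : ∀ F ∈ P₁, ∀ y ∈ F, y = x ∨ ∃ E ∈ Q₁, y ∈ E := by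
    intro F hF y hy
    refine (Finset.mem_insert.1 (hcov F (hP₁' F hF).1 hy)).imp_right fun hyN => ?_
    exact (toQ y hyN F (hP₁' F hF).1 (hP₁' F hF).2 hy).2 ((memP₁ F hF).2.2.2 y hy)
  have cov₂ : ∀ F ∈ P₂, ∀ y ∈ F, y = x ∨ ∃ E ∈ Q₂, y ∈ E := by
    intro F hF y hy
    refine (Finset.mem_insert.1 (hcov F (hP₂' F hF).1 hy)).imp_right fun hyN => ?_
    exact (toQ y hyN F (hP₂' F hF).1 (hP₂' F hF).2 hy).1 ((memP₂ F hF).2.2.2 y hy)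
  -- The vertex `x` helps to cover only one side, so the count is strict on the other. By `hcard`
  -- the two counts cannot both be strict, and if one is strict, the other is an equality, which
  -- permits an exchange in `N`.
  by_cases hxC : x ∈ C
  · have lt₁ : P₁.card < Q₁.card := by
      refine lt_of_covered P₁ Q₁ hP₁' memQ₁ ⟨A, hAQ₁⟩ fun F hF y hy => ?_
      refine (cov₁ F hF y hy).resolve_left ?_
      rintro rfl
      exact (memP₁ F hF).2.2.2 _ hy hxC
    by_cases hxB : x ∈ B
    · have lt₂ : P₂.card < Q₂.card := by
        refine lt_of_covered P₂ Q₂ hP₂' hQ₂' hQ₂ne fun F hF y hy => ?_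
        refine (cov₂ F hF y hy).resolve_left ?_
        rintro rfl
        exact (memP₂ F hF).2.2.1 (hM.eq_of_mem (hP₂' F hF).1 hBM hy hxB)
      omega
    · have le₂ := le_of_covered P₂ Q₂ hP₂' hQ₂' cov₂
      -- The exchange keeps `A`, gains at most the vertex `x`, and frees `B.erase s`, which has at
      -- least two vertices. This contradicts the minimality of `N`.
      have hsw : IsMatching Δ (k + 1) ((N \ Q₂) ∪ P₂) := by
        refine hN.swap (fun F hF => (hQ₂' F hF).1) (fun F hF => hM.1 F (hP₂' F hF).1)
          (fun F hF E hE => hM.2.1 F (hP₂' F hF).1 E (hP₂' E hE).1) (by omega) ?_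
        intro F hF E hE hEQ
        refine Finset.disjoint_left.2 fun y hyF hyE => ?_
        rcases cov₂ F hF y hyF with rfl | ⟨E', hE', hyE'⟩
        · exact hx (subset_support hE hyE)
        · exact hEQ (hN.eq_of_mem (hQ₂' E' hE').1 hE hyE' hyE ▸ hE')
      have h1 := hmin _ hsw (Finset.mem_union_left _ (Finset.mem_sdiff.2
        ⟨hAN, fun hA => (memQ₂ A hA).2.2.1 rfl⟩)) (by
          intro F hF
          rcases Finset.mem_union.1 hF with hF | hF
          · exact hNW F (Finset.mem_sdiff.1 hF).1
          · exact hMW F (hP₂' F hF).1)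
      have h2 : support ((N \ Q₂) ∪ P₂) ⊆ insert x (support N) \ B.erase s := by
        intro y hy
        obtain ⟨F, hF, hyF⟩ := mem_support.1 hy
        rw [Finset.mem_sdiff]
        rcases Finset.mem_union.1 hF with hF | hF
        · obtain ⟨hFN, hFQ⟩ := Finset.mem_sdiff.1 hF
          refine ⟨Finset.mem_insert_of_mem (subset_support hFN hyF), fun hyB => ?_⟩
          obtain ⟨hys, hyB⟩ := Finset.mem_erase.1 hyB
          obtain ⟨E, hE, hyE⟩ := hBQ y hyB hys (fun h => hxB (h ▸ hyB))
          exact hFQ (hN.eq_of_mem (hQ₂' E hE).1 hFN hyE hyF ▸ hE)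
        · refine ⟨hcov F (hP₂' F hF).1 hyF, fun hyB => ?_⟩
          exact (memP₂ F hF).2.2.1
            (hM.eq_of_mem (hP₂' F hF).1 hBM hyF (Finset.mem_of_mem_erase hyB))
      have h3 := Finset.card_le_card h2
      rw [Finset.card_sdiff_of_subset ((Finset.erase_subset _ _).trans (hcov B hBM)),
        Finset.card_insert_of_notMem hx, Finset.card_erase_of_mem hsB] at h3
      have h4 := hf.three_le
      have h5 := Finset.card_le_card ((Finset.erase_subset s B).trans (hcov B hBM))
      rw [Finset.card_insert_of_notMem hx, Finset.card_erase_of_mem hsB] at h5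
      omega
  · have lt₂ : P₂.card < Q₂.card := by
      refine lt_of_covered P₂ Q₂ hP₂' hQ₂' hQ₂ne fun F hF y hy => ?_
      refine (cov₂ F hF y hy).resolve_left ?_
      rintro rfl
      exact hxC ((memP₂ F hF).2.2.2 _ hy)
    have le₁ := le_of_covered P₁ Q₁ hP₁' memQ₁ cov₁
    -- This exchange removes `A` without bringing in `B`, against `Fork.mem_or_mem`.
    have hsw : IsMatching Δ (k + 1) ((N \ Q₁) ∪ P₁) := by
      refine hN.swap (fun F hF => (memQ₁ F hF).1) (fun F hF => hM.1 F (hP₁' F hF).1)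
        (fun F hF E hE => hM.2.1 F (hP₁' F hF).1 E (hP₁' E hE).1) (by omega) ?_
      intro F hF E hE hEQ
      refine Finset.disjoint_left.2 fun y hyF hyE => ?_
      rcases cov₁ F hF y hyF with rfl | ⟨E', hE', hyE'⟩
      · exact hx (subset_support hE hyE)
      · exact hEQ (hN.eq_of_mem (memQ₁ E' hE').1 hE hyE' hyE ▸ hE')
    have h1 := hf.mem_or_mem hY hd hsw (by
      intro F hF
      rcases Finset.mem_union.1 hF with hF | hF
      · exact hNW F (Finset.mem_sdiff.1 hF).1
      · exact hMW F (hP₁' F hF).1)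
    rcases h1 with h1 | h1 <;> rcases Finset.mem_union.1 h1 with h2 | h2
    · exact (Finset.mem_sdiff.1 h2).2 hAQ₁
    · exact hAM (hP₁' _ h2).1
    · exact hBN (Finset.mem_sdiff.1 h2).1
    · exact (memP₁ _ h2).2.2.1 rfl

end Fork

/-! ### Forks from closed neighborhoods in a tree -/

section Tree

variable {V : Type*} [Fintype V] [DecidableEq V] {T : SimpleGraph V} [DecidableRel T.Adj]

theorem mem_closedNbhd {u y : V} : y ∈ closedNbhd T u ↔ y = u ∨ T.Adj u y := by
  simp [closedNbhd]

theorem exists_eq_closedNbhd_of_mem_facets {F : Finset V}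
    (hF : F ∈ facets (closedNbhdComplex T)) : ∃ u, F = closedNbhd T u := by
  obtain ⟨u, hu, hmin⟩ := hF.1.2
  refine ⟨u, hu.antisymm (hF.2 ⟨⟨u, mem_closedNbhd.2 (Or.inl rfl)⟩, u, subset_rfl, hmin⟩ hu)⟩

/-- Root the tree at `s` and take for `C` the branch of `t`. The vertex `t₁` makes N[t] large
enough, and a third neighbor of `s` keeps N[s] from lying in N[r] ∪ N[t]. -/
theorem exists_fork (hT : T.IsTree) {r s t t₁ : V} (hrs : T.Adj r s) (hst : T.Adj s t)
    (htt : T.Adj t t₁) (hrt : r ≠ t) (hst₁ : s ≠ t₁) (hdeg : 3 ≤ T.degree s)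
    (hr : closedNbhd T r ∈ facets (closedNbhdComplex T))
    (ht : closedNbhd T t ∈ facets (closedNbhdComplex T)) :
    ∃ par h C, Fork par h (closedNbhdComplex T) s (closedNbhd T r) (closedNbhd T t) C := by
  obtain ⟨par, h, hroot, hadj, hpar⟩ := exists_isRooting hT s
  have par_s : ∀ y, T.Adj s y → par y = s := fun y hy =>
    (hpar s y hy).elim (fun h1 => absurd rfl h1.1) (fun h1 => h1.2)
  have star : ∀ u, u ≠ s → IsSubtree par h (closedNbhd T u) (par u) := by
    intro u hu
    refine ⟨mem_closedNbhd.2 (Or.inr (hadj u hu)), fun y hy hne => ?_⟩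
    rcases mem_closedNbhd.1 hy with rfl | hy
    · exact ⟨mem_closedNbhd.2 (Or.inr (hadj y hu)), hroot.lt_height y hu⟩
    · rcases hpar u y hy with h1 | h1
      · exact absurd h1.2.symm hne
      · exact ⟨mem_closedNbhd.2 (Or.inl h1.2), hroot.lt_height y h1.1⟩
  have star_s : IsSubtree par h (closedNbhd T s) s := by
    refine ⟨mem_closedNbhd.2 (Or.inl rfl), fun y hy hne => ?_⟩
    have hy := (mem_closedNbhd.1 hy).resolve_left hne
    rw [par_s y hy]
    exact ⟨mem_closedNbhd.2 (Or.inl rfl), par_s y hy ▸ hroot.lt_height y hne⟩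
  have children : ∀ u y, T.Adj s u → y ∈ closedNbhd T u → y ≠ s → y = u ∨ par y = u := by
    intro u y hu hy hys
    refine (mem_closedNbhd.1 hy).imp_right fun hy => ?_
    refine ((hpar u y hy).resolve_left fun h1 => hys ?_).2
    rw [← h1.2, par_s u hu]
  have disj : ∀ u v y, T.Adj s u → T.Adj s v → u ≠ v → y ∈ closedNbhd T u →
      y ∈ closedNbhd T v → y = s := by
    intro u v y hu hv huv hyu hyv
    by_contra hys
    rcases children u y hu hyu hys with h1 | h1 <;> rcases children v y hv hyv hys with h2 | h2
    · exact huv (h1.symm.trans h2)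
    · rw [h1, par_s u hu] at h2
      exact hv.ne h2
    · rw [h2, par_s v hv] at h1
      exact hu.ne h1
    · exact huv (h1.symm.trans h2)
  -- A child `u` of `v` has no neighbor in N[w] other than possibly `v`, so its neighborhood cannot
  -- use N[w] to escape N[v].
  have only : ∀ v w u, T.Adj s v → T.Adj s w → v ≠ w → u ≠ s → u ∈ closedNbhd T v →
      closedNbhd T u ⊆ closedNbhd T v ∪ closedNbhd T w → closedNbhd T u ⊆ closedNbhd T v := by
    intro v w u hv hw hvw hus huv hsub y hy
    rcases children v u hv huv hus with rfl | h1
    · exact hy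
    rcases Finset.mem_union.1 (hsub hy) with h2 | h2
    · exact h2
    by_cases hys : y = s
    · rw [hys]
      exact mem_closedNbhd.2 (Or.inr hv.symm)
    rcases mem_closedNbhd.1 hy with rfl | hy
    · exact huv
    rcases hpar u y hy with h3 | h3
    · rw [← h3.2, h1]
      exact mem_closedNbhd.2 (Or.inl rfl)
    rcases children w y hw h2 hys with rfl | h4
    · exact absurd (h3.2.symm.trans (par_s y hw)) hus
    · have : u = w := h3.2.symm.trans h4
      rw [this, par_s w hw] at h1
      exact absurd h1 hv.ne
  have hsr := hrs.symm
  refine ⟨par, h, branch par t, ?_, ?_, hr, ht, par_s r hsr ▸ star r hrs.ne,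
    par_s t hst ▸ star t hst.ne', ?_, fun y => disj r t y hsr hst hrt, ?_, ?_, ?_, ?_⟩
  · intro F hF
    obtain ⟨u, rfl⟩ := exists_eq_closedNbhd_of_mem_facets hF
    by_cases hu : u = s
    · exact ⟨s, hu ▸ star_s⟩
    · exact ⟨_, star u hu⟩
  · intro F hF
    obtain ⟨u, rfl⟩ := exists_eq_closedNbhd_of_mem_facets hF
    obtain ⟨w, hw⟩ : ∃ w, T.Adj u w := by
      by_cases hu : u = s
      · exact ⟨r, hu ▸ hsr⟩
      · exact ⟨_, hadj u hu⟩
    have h1 : ({u, w} : Finset V) ⊆ closedNbhd T u := by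
      intro y hy
      simp only [Finset.mem_insert, Finset.mem_singleton] at hy
      rcases hy with rfl | rfl
      · exact mem_closedNbhd.2 (Or.inl rfl)
      · exact mem_closedNbhd.2 (Or.inr hw)
    have h2 := Finset.card_le_card h1
    rwa [Finset.card_pair hw.ne] at h2
  · have h1 : ({s, t, t₁} : Finset V) ⊆ closedNbhd T t := by
      intro y hy
      simp only [Finset.mem_insert, Finset.mem_singleton] at hy
      rcases hy with rfl | rfl | rfl
      · exact mem_closedNbhd.2 (Or.inr hst.symm)
      · exact mem_closedNbhd.2 (Or.inl rfl)
      · exact mem_closedNbhd.2 (Or.inr htt)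
    have h2 := Finset.card_le_card h1
    rwa [Finset.card_eq_three.2 ⟨s, t, t₁, hst.ne, hst₁, htt.ne, rfl⟩] at h2
  · intro F hF hsub
    obtain ⟨u, rfl⟩ := exists_eq_closedNbhd_of_mem_facets hF
    by_cases hus : u = s
    · subst hus
      have h1 : 0 < (((T.neighborFinset u).erase r).erase t).card := by
        have h2 := Finset.pred_card_le_card_erase (s := T.neighborFinset u) (a := r)
        have h3 := Finset.pred_card_le_card_erase (s := (T.neighborFinset u).erase r) (a := t)
        rw [T.card_neighborFinset_eq_degree] at h2
        omega
      obtain ⟨q, hq⟩ := Finset.card_pos.1 h1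
      simp only [Finset.mem_erase, SimpleGraph.mem_neighborFinset] at hq
      obtain ⟨hqt, hqr, hq⟩ := hq
      have hqq : q ∈ closedNbhd T q := mem_closedNbhd.2 (Or.inl rfl)
      rcases Finset.mem_union.1 (hsub (mem_closedNbhd.2 (Or.inr hq))) with h2 | h2
      · exact absurd (disj q r q hq hsr hqr hqq h2) hq.ne'
      · exact absurd (disj q t q hq hst hqt hqq h2) hq.ne'
    · rcases Finset.mem_union.1 (hsub (mem_closedNbhd.2 (Or.inl rfl))) with h2 | h2
      · exact Or.inl (eq_of_subset_of_mem_facets hF hr (only r t u hsr hst hrt hus h2 hsub))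
      · exact Or.inr (eq_of_subset_of_mem_facets hF ht
          (only t r u hst hsr hrt.symm hus h2 (by rwa [Finset.union_comm])))
  · have hs := hroot.root_notMem_branch hst.ne'
    have hrb : r ∉ branch par t := by
      rw [← par_mem_branch_iff hrt, par_s r hsr]
      exact hs
    intro y hy hyb
    by_cases hys : y = s
    · exact hs (hys ▸ hyb)
    rcases children r y hsr hy hys with rfl | h1
    · exact hrb hyb
    · by_cases hyt : y = t
      · subst hyt
        exact hrs.ne (h1.symm.trans (par_s y hst))
      · rw [← par_mem_branch_iff hyt, h1] at hyb
        exact hrb hyb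
  · intro y hy hys
    rcases children t y hst hy hys with rfl | h1
    · exact mem_branch_self y
    · exact ⟨1, h1⟩
  · intro F hF hsF y hy hyb z hz
    have hpt : par t ∉ F := by rwa [par_s t hst]
    obtain ⟨x, hx⟩ : ∃ x, IsSubtree par h F x := by
      obtain ⟨u, rfl⟩ := exists_eq_closedNbhd_of_mem_facets hF
      by_cases hu : u = s
      · exact ⟨s, hu ▸ star_s⟩
      · exact ⟨_, star u hu⟩
    rw [hx.mem_branch_iff hpt z hz, ← hx.mem_branch_iff hpt y hy]
    exact hyb

end Tree

/-! ### Exponents of squarefree monomials -/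

section Monomials

variable {V : Type*}

/-- The exponent vector of the squarefree monomial `x_C`. -/
def exponent (C : Finset V) : V →₀ ℕ := ∑ u ∈ C, Finsupp.single u 1

theorem sqfreeMonomial_eq {K : Type*} [Field K] (C : Finset V) :
    sqfreeMonomial K C = MvPolynomial.monomial (exponent C) 1 := by
  simp [sqfreeMonomial, exponent, MvPolynomial.monomial_sum_one, MvPolynomial.X]

theorem degree_exponent (C : Finset V) : (exponent C).degree = C.card := by
  simp [exponent, map_sum]

variable [DecidableEq V]

theorem exponent_apply (C : Finset V) (u : V) : exponent C u = if u ∈ C then 1 else 0 := by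
  simp [exponent, Finsupp.finsetSum_apply, Finsupp.single_apply]

theorem exponent_le_iff {C D : Finset V} : exponent C ≤ exponent D ↔ C ⊆ D := by
  constructor
  · intro hle u hu
    have := hle u
    rw [exponent_apply, exponent_apply, if_pos hu] at this
    by_contra hD
    simp [hD] at this
  · intro hCD u
    rw [exponent_apply, exponent_apply]
    by_cases hu : u ∈ C
    · simp [hu, hCD hu]
    · simp [hu]

theorem eq_exponent_of_le {e : V →₀ ℕ} {C : Finset V} (he : e ≤ exponent C) :
    e = exponent e.support := by
  ext u
  have := he u
  rw [exponent_apply] at this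
  rw [exponent_apply]
  by_cases hu : e u = 0
  · simp [hu]
  · simp only [Finsupp.mem_support_iff, ne_eq, hu, not_false_eq_true, if_true]
    split_ifs at this <;> omega

theorem support_subset_of_le {e : V →₀ ℕ} {C : Finset V} (he : e ≤ exponent C) :
    e.support ⊆ C := by
  rw [← exponent_le_iff, ← eq_exponent_of_le he]
  exact he

theorem exponent_union {C D : Finset V} (h : Disjoint C D) :
    exponent (C ∪ D) = exponent C + exponent D :=
  Finset.sum_union h

theorem exponent_sdiff_add {C D : Finset V} (h : C ⊆ D) :
    exponent (D \ C) + exponent C = exponent D := by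
  rw [← exponent_union Finset.sdiff_disjoint, Finset.sdiff_union_of_subset h]

end Monomials

/-! ### Squarefree powers and matchings -/

section SquarefreePower

variable {V : Type*} {K : Type*} [Field K] {Δ : PreAbstractSimplicialComplex V}

theorem exists_multiset_of_mem_pow {k : ℕ} {f : MvPolynomial V K} (hf : f ∈ facetIdeal K Δ ^ k) :
    ∀ e ∈ f.support, ∃ m : Multiset (Finset V), m.card = k ∧ (∀ F ∈ m, F ∈ facets Δ) ∧
      (m.map exponent).sum ≤ e := by
  have key : facetIdeal K Δ ^ k ≤ Ideal.span ((fun e => MvPolynomial.monomial e (1 : K)) ''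
      {e | ∃ m : Multiset (Finset V), m.card = k ∧ (∀ F ∈ m, F ∈ facets Δ) ∧
        (m.map exponent).sum = e}) := by
    induction k generalizing f with
    | zero =>
      rw [pow_zero, Ideal.one_eq_top]
      refine (Ideal.eq_top_of_isUnit_mem _ (x := 1) (Ideal.subset_span ?_) isUnit_one).ge
      exact ⟨0, ⟨0, by simp⟩, by simp⟩
    | succ k ih =>
      rw [pow_succ]
      -- The inclusion of ideals does not involve `f`; the value 0 only discharges the membership
      -- hypothesis carried through the induction.
      refine (Ideal.mul_mono_left (ih (f := 0) (Ideal.zero_mem _))).trans ?_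
      rw [facetIdeal, Ideal.span_mul_span', Ideal.span_le]
      rintro _ ⟨_, ⟨_, ⟨m, hm, hmF, rfl⟩, rfl⟩, _, ⟨F, hF, rfl⟩, rfl⟩
      refine Ideal.subset_span ⟨_, ⟨F ::ₘ m, by simp [hm], ?_, rfl⟩, ?_⟩
      · intro E hE
        rcases Multiset.mem_cons.1 hE with rfl | hE
        · exact hF
        · exact hmF E hE
      · simp [sqfreeMonomial_eq, MvPolynomial.monomial_mul, add_comm]
  intro e he
  obtain ⟨_, ⟨m, h1, h2, rfl⟩, h3⟩ := MvPolynomial.mem_ideal_span_monomial_image.1 (key hf) e he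
  exact ⟨m, h1, h2, h3⟩

variable [DecidableEq V]

/-- A product of facet monomials dividing a squarefree monomial has pairwise disjoint factors, so a
multiset of facets becomes a matching. -/
theorem exists_isMatching_of_sum_le (m : Multiset (Finset V)) :
    ∀ C : Finset V, (∀ F ∈ m, F ∈ facets Δ) → (m.map exponent).sum ≤ exponent C →
      ∃ M, IsMatching Δ m.card M ∧ support M ⊆ C := by
  induction m using Multiset.induction with
  | empty => exact fun C _ _ => ⟨∅, by simp [IsMatching], by simp [support]⟩
  | cons F m ih =>
    intro C hm hle
    rw [Multiset.map_cons, Multiset.sum_cons] at hle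
    have hFC : F ⊆ C := exponent_le_iff.1 (le_self_add.trans hle)
    rw [← exponent_sdiff_add hFC, add_comm (exponent (C \ F))] at hle
    obtain ⟨M, hM, hMC⟩ := ih (C \ F) (fun E hE => hm E (Multiset.mem_cons_of_mem hE))
      (le_of_add_le_add_left hle)
    have hd : ∀ E ∈ M, Disjoint F E := fun E hE =>
      Finset.disjoint_left.2 fun y hyF hyE =>
        (Finset.mem_sdiff.1 (hMC (subset_support hE hyE))).2 hyF
    have hF := hm F (Multiset.mem_cons_self _ _)
    have hFM : F ∉ M := by
      intro hFM
      have h1 := hd F hFM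
      rw [disjoint_self] at h1
      exact (Δ.isRelLowerSet_faces hF.1).1.ne_empty h1
    refine ⟨insert F M, ⟨?_, ?_, ?_⟩, ?_⟩
    · intro E hE
      rcases Finset.mem_insert.1 hE with rfl | hE
      · exact hF
      · exact hM.1 E hE
    · intro E hE E' hE' hne
      rcases Finset.mem_insert.1 hE with h1 | h1 <;> rcases Finset.mem_insert.1 hE' with h2 | h2
      · exact absurd (h1.trans h2.symm) hne
      · exact h1 ▸ hd E' h2
      · exact h2 ▸ (hd E h1).symm
      · exact hM.2.1 E h1 E' h2 hne
    · rw [Finset.card_insert_of_notMem hFM, hM.2.2, Multiset.card_cons]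
    · intro y hy
      obtain ⟨E, hE, hyE⟩ := mem_support.1 hy
      rcases Finset.mem_insert.1 hE with rfl | hE
      · exact hFC hyE
      · exact (Finset.mem_sdiff.1 (hMC (subset_support hE hyE))).1

theorem sqfreeMonomial_mem_squarefreePower {k : ℕ} {M : Finset (Finset V)}
    (hM : IsMatching Δ k M) {A : Finset V} (hA : support M ⊆ A) :
    sqfreeMonomial K A ∈ squarefreePower (facetIdeal K Δ) k := by
  have h1 : sqfreeMonomial K (support M) ∈ facetIdeal K Δ ^ k := by
    have h2 : sqfreeMonomial K (support M) = ∏ F ∈ M, sqfreeMonomial K F :=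
      Finset.prod_biUnion fun F hF E hE hne => hM.2.1 F hF E hE hne
    have h3 : facetIdeal K Δ ^ k = ∏ _F ∈ M, facetIdeal K Δ := by
      rw [Finset.prod_const, hM.2.2]
    rw [h2, h3]
    exact Ideal.prod_mem_prod fun F hF => Ideal.subset_span ⟨F, hM.1 F hF, rfl⟩
  have h4 : sqfreeMonomial K A = sqfreeMonomial K (A \ support M) * sqfreeMonomial K (support M) :=
    (Finset.prod_sdiff hA).symm
  rw [h4]
  exact Ideal.mul_mem_left _ _ (Ideal.subset_span ⟨_, rfl, h1⟩)

theorem exists_isMatching_of_mem_squarefreePower {k : ℕ} {f : MvPolynomial V K}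
    (hf : f ∈ squarefreePower (facetIdeal K Δ) k) {e : V →₀ ℕ} (he : e ∈ f.support) :
    ∃ M, IsMatching Δ k M ∧ exponent (support M) ≤ e := by
  have h1 : squarefreePower (facetIdeal K Δ) k = Ideal.span
      ((fun e => MvPolynomial.monomial e (1 : K)) ''
        {e | ∃ A : Finset V, e = exponent A ∧ sqfreeMonomial K A ∈ facetIdeal K Δ ^ k}) := by
    rw [squarefreePower]
    congr 1
    ext m
    constructor
    · rintro ⟨A, rfl, hA⟩
      exact ⟨_, ⟨A, rfl, hA⟩, (sqfreeMonomial_eq A).symm⟩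
    · rintro ⟨_, ⟨A, rfl, hA⟩, rfl⟩
      exact ⟨A, (sqfreeMonomial_eq A).symm, by simpa only [← sqfreeMonomial_eq] using hA⟩
  rw [h1] at hf
  obtain ⟨_, ⟨A, rfl, hA⟩, hle⟩ := MvPolynomial.mem_ideal_span_monomial_image.1 hf e he
  obtain ⟨m, rfl, hmF, hmA⟩ := exists_multiset_of_mem_pow hA (exponent A)
    (by rw [sqfreeMonomial_eq]; simp)
  obtain ⟨M, hM, hMA⟩ := exists_isMatching_of_sum_le m A hmF hmA
  exact ⟨M, hM, (exponent_le_iff.2 hMA).trans hle⟩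

end SquarefreePower

/-! ### Linear resolutions and connectedness -/

section Resolution

open MvPolynomial

variable {V : Type*} {K : Type*} [Field K]

theorem MinimalGradedFreeResolution.shift_eq {I : Ideal (MvPolynomial V K)}
    (F : MinimalGradedFreeResolution I) {d : ℕ}
    (h : ∀ (i : ℕ) (j : ℤ), j ≠ i + d → F.betti i j = 0) (i : ℕ) (b : Fin (F.rank i)) :
    F.shift i b = i + d := by
  by_contra hne
  have h1 := h i _ hne
  rw [MinimalGradedFreeResolution.betti, Finset.card_eq_zero] at h1
  exact Finset.filter_eq_empty_iff.1 h1 (Finset.mem_univ b) rfl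

theorem le_degree_of_mem_degreeComponent {I : Ideal (MvPolynomial V K)} {j : ℕ}
    {f : MvPolynomial V K} (hf : f ∈ degreeComponent I j) : ∀ e ∈ f.support, j ≤ e.degree := by
  have h1 : degreeComponent I j ≤ idealOfVars V K ^ j := by
    rw [degreeComponent, Ideal.span_le]
    rintro g ⟨-, hg⟩
    refine (mem_pow_idealOfVars_iff j g).2 fun e he => ?_
    have h1 : Finsupp.weight (fun _ => 1) e = j := hg (mem_support_iff.1 he)
    rw [← Finsupp.degree_eq_weight_one] at h1
    exact h1.ge
  exact (mem_pow_idealOfVars_iff j f).1 (h1 hf)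

/-- The coefficient at `n` sees the `g' b` only at exponents below `n`. The values 0 and 1 of `ε`
express that a truncation kills or keeps everything there. -/
theorem coeff_sum_mul_eq {ι : Type*} [DecidableEq V] {n : V →₀ ℕ} {ε : K} (u : Finset ι)
    (c g g' : ι → MvPolynomial V K)
    (hg : ∀ b ∈ u, ∀ e ≤ n, coeff e (g' b) = ε * coeff e (g b)) :
    coeff n (∑ b ∈ u, c b * g' b) = ε * coeff n (∑ b ∈ u, c b * g b) := by
  simp only [coeff_sum, coeff_mul, Finset.mul_sum]
  refine Finset.sum_congr rfl fun b hb => Finset.sum_congr rfl fun x hx => ?_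
  rw [hg b hb x.2 (Finset.HasAntidiagonal.mem_antidiagonal.1 hx ▸ le_add_self)]
  ring

/-- The part of `f` with exponents satisfying `R`. -/
def restrictExponents (R : (V →₀ ℕ) → Prop) [DecidablePred R] (f : MvPolynomial V K) :
    MvPolynomial V K :=
  ∑ e ∈ f.support.filter R, monomial e (coeff e f)

theorem coeff_restrictExponents [DecidableEq V] (R : (V →₀ ℕ) → Prop) [DecidablePred R]
    (f : MvPolynomial V K) (e : V →₀ ℕ) :
    coeff e (restrictExponents R f) = if R e then coeff e f else 0 := by
  simp only [restrictExponents, coeff_sum, coeff_monomial, Finset.sum_ite_eq', Finset.mem_filter,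
    mem_support_iff]
  split_ifs <;> simp_all

/-- If `I_⟨j⟩` has a linear resolution, then the squarefree monomials of degree `j` in `I`
supported in `W` are connected by linear relations. -/
theorem exists_linear_relation [DecidableEq V] {I : Ideal (MvPolynomial V K)} {j : ℕ}
    (hlin : HasLinearResolution (degreeComponent I j))
    (hI : ∀ f ∈ I, ∀ e ∈ f.support, monomial e (1 : K) ∈ I) {W : Finset V} (R : Finset V → Prop)
    {A B : Finset V} (hAW : A ⊆ W) (hBW : B ⊆ W) (hAj : A.card = j) (hBj : B.card = j)
    (hA : sqfreeMonomial K A ∈ I) (hB : sqfreeMonomial K B ∈ I) (hRA : R A) (hRB : ¬ R B) :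
    ∃ C D x, C ⊆ W ∧ D ⊆ W ∧ C.card = j ∧ D.card = j ∧ sqfreeMonomial K C ∈ I ∧
      sqfreeMonomial K D ∈ I ∧ R C ∧ ¬ R D ∧ D ⊆ insert x C := by
  classical
  by_contra hcon
  obtain ⟨d, F, hF⟩ := hlin
  have hgen : ∀ b, F.gen b ∈ degreeComponent I j := by
    intro b
    have h1 : F.gen b ∈ Ideal.span (Set.range F.gen) := Ideal.subset_span ⟨b, rfl⟩
    rwa [F.span_gen] at h1
  have hgI : ∀ b, F.gen b ∈ I := fun b =>
    (Ideal.span_le.2 fun f hf => hf.1 : degreeComponent I j ≤ I) (hgen b)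
  have hspan : ∀ C : Finset V, C.card = j → sqfreeMonomial K C ∈ I →
      ∃ c : Fin (F.rank 0) → MvPolynomial V K, ∑ b, c b * F.gen b = sqfreeMonomial K C := by
    intro C hC hCI
    rw [← Ideal.mem_span_range_iff_exists_fun, F.span_gen]
    refine Ideal.subset_span ⟨hCI, ?_⟩
    rw [sqfreeMonomial_eq, ← hC, ← degree_exponent]
    exact isHomogeneous_monomial 1 rfl
  have hgd : ∀ b e, coeff e (F.gen b) ≠ 0 → e.degree = d := by
    intro b e he
    have h1 := F.gen_homogeneous b e (mem_support_iff.2 he)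
    rw [F.shift_eq hF] at h1
    simpa using h1
  obtain ⟨a, ha⟩ := hspan A hAj hA
  obtain ⟨b, hb⟩ := hspan B hBj hB
  -- Some generator has an exponent dividing x_A; its degree is `d`, at most `j`, and at least `j`
  -- because it occurs in the degree component.
  have hdj : d = j := by
    have h1 : ∃ b, ∃ e ≤ exponent A, coeff e (F.gen b) ≠ 0 := by
      by_contra hne
      push Not at hne
      have h2 := coeff_sum_mul_eq (n := exponent A) (ε := 0) Finset.univ a (fun _ => 0) F.gen
        fun b _ e he => by simp [hne b e he]
      rw [ha, sqfreeMonomial_eq] at h2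
      simp at h2
    obtain ⟨b, e, hle, he⟩ := h1
    have h2 := le_degree_of_mem_degreeComponent (hgen b) e (mem_support_iff.2 he)
    have h3 := Finsupp.degree_mono hle
    rw [degree_exponent, hAj] at h3
    rw [hgd b e he] at h2 h3
    omega
  have hg : ∀ b e (N : Finset V), e ≤ exponent N → coeff e (F.gen b) ≠ 0 →
      e.support ⊆ N ∧ e.support.card = j ∧ sqfreeMonomial K e.support ∈ I := by
    intro b e N hle he
    refine ⟨support_subset_of_le hle, ?_, ?_⟩
    · rw [← degree_exponent, ← eq_exponent_of_le hle, hgd b e he, hdj]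
    · rw [sqfreeMonomial_eq, ← eq_exponent_of_le hle]
      exact hI _ (hgI b) e (mem_support_iff.2 he)
  let g' : Fin (F.rank 0) → MvPolynomial V K :=
    fun b => restrictExponents (fun e => R e.support) (F.gen b)
  have hg' : ∀ b e, coeff e (g' b) = if R e.support then coeff e (F.gen b) else 0 :=
    fun b e => coeff_restrictExponents _ _ _
  have hrel : ∀ k, ∑ b, F.diff 0 b k * F.gen b = 0 := by
    intro k
    have h1 := (F.exact_gen ((F.diff 0).mulVecLin (Pi.single k 1))).2 ⟨_, rfl⟩
    simpa [Fintype.linearCombination_apply, Matrix.mulVecLin_apply] using h1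
  -- Syzygy entries are linear, so only exponents of sets `N` with j + 1 elements matter. Any two
  -- j-subsets of `N` differ by one exchange; by `hcon` those in the ideal all satisfy `R` or all
  -- fail it. So truncation keeps the whole relation or kills it.
  have hzero : ∀ k, ∀ e ≤ exponent W, coeff e (∑ b, F.diff 0 b k * g' b) = 0 := by
    intro k e hle
    by_contra hne
    have hdeg : e.degree = j + 1 := by
      rw [coeff_sum] at hne
      obtain ⟨b, -, hb⟩ := Finset.exists_ne_zero_of_sum_ne_zero hne
      rw [coeff_mul] at hb
      obtain ⟨x, hx, hxne⟩ := Finset.exists_ne_zero_of_sum_ne_zero hb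
      have h1 := F.diff_homogeneous 0 b k x.1 (mem_support_iff.2 (left_ne_zero_of_mul hxne))
      rw [F.shift_eq hF, F.shift_eq hF] at h1
      have h2 := right_ne_zero_of_mul hxne
      rw [hg'] at h2
      have h3 := hgd b x.2 (fun h0 => h2 (by simp [h0]))
      rw [← Finset.HasAntidiagonal.mem_antidiagonal.1 hx, map_add, h3, hdj]
      push_cast at h1
      omega
    have hNW := support_subset_of_le hle
    have heN := eq_exponent_of_le hle
    obtain ⟨N, hN⟩ : ∃ N, N = e.support := ⟨_, rfl⟩
    rw [← hN] at hNW heN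
    have hNj : N.card = j + 1 := by rw [← degree_exponent, ← heN, hdeg]
    subst heN
    by_cases hex : ∃ C ⊆ N, C.card = j ∧ sqfreeMonomial K C ∈ I ∧ R C
    · obtain ⟨C, hCN, hCj, hCI, hRC⟩ := hex
      have h1 := coeff_sum_mul_eq (n := exponent N) (ε := 1) Finset.univ (fun b => F.diff 0 b k)
        F.gen g' (by
          intro b _ e he
          rw [hg', one_mul, ite_eq_left_iff]
          intro hR
          by_contra h0
          obtain ⟨h2, h3, h4⟩ := hg b e N he (Ne.symm h0)
          obtain ⟨x, hx⟩ : ∃ x, N \ C = {x} := by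
            rw [← Finset.card_eq_one, Finset.card_sdiff_of_subset hCN]
            omega
          refine hcon ⟨C, e.support, x, hCN.trans hNW, h2.trans hNW, hCj, h3, hCI, h4, hRC, hR, ?_⟩
          intro y hy
          by_cases hyC : y ∈ C
          · exact Finset.mem_insert_of_mem hyC
          · have : y ∈ N \ C := Finset.mem_sdiff.2 ⟨h2 hy, hyC⟩
            rw [hx, Finset.mem_singleton] at this
            exact Finset.mem_insert.2 (Or.inl this))
      rw [hrel] at h1
      exact hne (by simpa using h1)
    · have h1 := coeff_sum_mul_eq (n := exponent N) (ε := 0) Finset.univ (fun b => F.diff 0 b k)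
        F.gen g' (by
          intro b _ e he
          rw [hg', zero_mul, ite_eq_right_iff]
          intro hR
          by_contra h0
          obtain ⟨h2, h3, h4⟩ := hg b e N he h0
          exact hex ⟨_, h2, h3, h4, hR⟩)
      exact hne (by simpa using h1)
  -- The syzygy expressing x_W in two ways, through x_A and through x_B. Being a combination of
  -- first syzygies, it also vanishes at x_W on the truncated generators, whereas there the x_A part
  -- contributes 1 and the x_B part 0.
  let p : Fin (F.rank 0) → MvPolynomial V K := fun i =>
    monomial (exponent (W \ A)) 1 * a i - monomial (exponent (W \ B)) 1 * b i
  have hsum : ∀ f : Fin (F.rank 0) → MvPolynomial V K, ∑ i, p i * f i =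
      monomial (exponent (W \ A)) 1 * ∑ i, a i * f i -
        monomial (exponent (W \ B)) 1 * ∑ i, b i * f i := by
    intro f
    rw [Finset.mul_sum, Finset.mul_sum, ← Finset.sum_sub_distrib]
    exact Finset.sum_congr rfl fun i _ => by simp only [p]; ring
  have hp : ∑ i, p i * F.gen i = 0 := by
    rw [hsum, ha, hb, sqfreeMonomial_eq, sqfreeMonomial_eq, monomial_mul, monomial_mul,
      exponent_sdiff_add hAW, exponent_sdiff_add hBW, sub_self]
  obtain ⟨q, hq⟩ := (F.exact_gen p).1 (by simpa [Fintype.linearCombination_apply] using hp)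
  have hpq : ∑ i, p i * g' i = ∑ k, q k * ∑ b, F.diff 0 b k * g' b := by
    simp only [← hq, Matrix.mulVecLin_apply, Matrix.mulVec, dotProduct, Finset.sum_mul,
      Finset.mul_sum]
    rw [Finset.sum_comm]
    exact Finset.sum_congr rfl fun i _ => Finset.sum_congr rfl fun k _ => by ring
  have h0 := coeff_sum_mul_eq (n := exponent W) (ε := 0) Finset.univ q (fun _ => 0)
    (fun k => ∑ b, F.diff 0 b k * g' b) fun k _ e he => by simp [hzero k e he]
  rw [← hpq, hsum, coeff_sub, zero_mul] at h0
  nth_rewrite 1 [← exponent_sdiff_add hAW] at h0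
  nth_rewrite 1 [← exponent_sdiff_add hBW] at h0
  rw [coeff_monomial_mul, coeff_monomial_mul] at h0
  have heq : ∀ (C : Finset V) i e, C.card = j → e ≤ exponent C → coeff e (F.gen i) ≠ 0 →
      e.support = C := by
    intro C i e hC he hne
    obtain ⟨h1, h2, -⟩ := hg i e C he hne
    exact Finset.eq_of_subset_of_card_le h1 (by omega)
  have hcA := coeff_sum_mul_eq (n := exponent A) (ε := 1) Finset.univ a F.gen g' (by
    intro i _ e he
    rw [hg', one_mul, ite_eq_left_iff]
    intro hR
    by_contra hne
    exact hR (heq A i e hAj he (Ne.symm hne) ▸ hRA))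
  have hcB := coeff_sum_mul_eq (n := exponent B) (ε := 0) Finset.univ b F.gen g' (by
    intro i _ e he
    rw [hg', zero_mul, ite_eq_right_iff]
    intro hR
    by_contra hne
    exact hRB (heq B i e hBj he hne ▸ hR))
  rw [hcA, hcB, ha, hb, sqfreeMonomial_eq] at h0
  simp at h0

end Resolution

/-! ### Disconnecting the two kinds of matchings -/

section Main

variable {V : Type*} [DecidableEq V] {K : Type*} [Field K] {Δ : PreAbstractSimplicialComplex V}

theorem monomial_mem_squarefreePower {k : ℕ} {f : MvPolynomial V K}
    (hf : f ∈ squarefreePower (facetIdeal K Δ) k) {e : V →₀ ℕ} (he : e ∈ f.support) :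
    MvPolynomial.monomial e (1 : K) ∈ squarefreePower (facetIdeal K Δ) k := by
  obtain ⟨M, hM, hle⟩ := exists_isMatching_of_mem_squarefreePower hf he
  have h1 := sqfreeMonomial_mem_squarefreePower (K := K) hM subset_rfl
  have h2 := Ideal.mul_mem_left _ (MvPolynomial.monomial (e - exponent (support M)) (1 : K)) h1
  rwa [sqfreeMonomial_eq, MvPolynomial.monomial_mul, one_mul, tsub_add_cancel_of_le hle] at h2

theorem sqfreeMonomial_mem_squarefreePower_iff {k : ℕ} {A : Finset V} :
    sqfreeMonomial K A ∈ squarefreePower (facetIdeal K Δ) k ↔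
      ∃ M, IsMatching Δ k M ∧ support M ⊆ A := by
  constructor
  · intro hA
    obtain ⟨M, hM, hle⟩ := exists_isMatching_of_mem_squarefreePower hA (e := exponent A)
      (by rw [sqfreeMonomial_eq]; simp)
    exact ⟨M, hM, exponent_le_iff.1 hle⟩
  · rintro ⟨M, hM, hMA⟩
    exact sqfreeMonomial_mem_squarefreePower hM hMA

/-- Among the `k`-matchings inside `W` through a given facet, pick one covering the fewest
vertices. -/
theorem exists_min_isMatching {k : ℕ} {W F : Finset V} {M : Finset (Finset V)}
    (hM : IsMatching Δ k M) (hF : F ∈ M) (hW : ∀ E ∈ M, E ⊆ W) :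
    ∃ N, (IsMatching Δ k N ∧ F ∈ N ∧ ∀ E ∈ N, E ⊆ W) ∧
      ∀ N', IsMatching Δ k N' → F ∈ N' → (∀ E ∈ N', E ⊆ W) →
        (support N).card ≤ (support N').card := by
  obtain ⟨N, hN, hmin⟩ := WellFounded.has_min
    (measure fun N : Finset (Finset V) => (support N).card).wf
    {N | IsMatching Δ k N ∧ F ∈ N ∧ ∀ E ∈ N, E ⊆ W} ⟨M, hM, hF, hW⟩
  exact ⟨N, hN, fun N' h1 h2 h3 => not_lt.1 (hmin N' ⟨h1, h2, h3⟩)⟩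

variable {par : V → V} {h : V → ℕ} {s : V} {A B : Finset V} {C : Set V}

theorem support_subset_iff {M : Finset (Finset V)} {D : Finset V} :
    support M ⊆ D ↔ ∀ F ∈ M, F ⊆ D :=
  Finset.biUnion_subset

theorem Fork.not_isComponentwiseLinear_of_le (hf : Fork par h Δ s A B C) {k : ℕ}
    {Y N M : Finset (Finset V)} (hY : IsMatching Δ k Y) (hd : ∀ F ∈ Y, Disjoint F (A ∪ B))
    (hN : IsMatching Δ (k + 1) N) (hAN : A ∈ N) (hNW : ∀ F ∈ N, F ⊆ A ∪ B ∪ support Y)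
    (hmin : ∀ N', IsMatching Δ (k + 1) N' → A ∈ N' → (∀ F ∈ N', F ⊆ A ∪ B ∪ support Y) →
      (support N).card ≤ (support N').card)
    (hM : IsMatching Δ (k + 1) M) (hBM : B ∈ M) (hMW : ∀ F ∈ M, F ⊆ A ∪ B ∪ support Y)
    (hle : (support M).card ≤ (support N).card) :
    ¬ IsComponentwiseLinear (squarefreePower (facetIdeal K Δ) (k + 1)) := by
  intro hlin
  have hNW' := support_subset_iff.2 hNW
  -- Padding the support of `M` inside W makes both monomials of the same degree.
  obtain ⟨D, hMD, hDW, hDc⟩ := Finset.exists_subsuperset_card_eq (support_subset_iff.2 hMW) hle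
    (Finset.card_le_card hNW')
  let R : Finset V → Prop := fun E =>
    ∃ N', IsMatching Δ (k + 1) N' ∧ A ∈ N' ∧ support N' ⊆ E
  have hR : ∀ E ⊆ A ∪ B ∪ support Y, E.card = (support N).card → ∀ N', IsMatching Δ (k + 1) N' →
      A ∈ N' → support N' ⊆ E → support N' = E := by
    intro E hEW hE N' hN' hAN' hsub
    have h1 := hmin N' hN' hAN' (support_subset_iff.1 (hsub.trans hEW))
    exact Finset.eq_of_subset_of_card_le hsub (by omega)
  have key : ∀ E E' x, E ⊆ A ∪ B ∪ support Y → E' ⊆ A ∪ B ∪ support Y →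
      E.card = (support N).card → R E → E' ⊆ insert x E → ∀ M', IsMatching Δ (k + 1) M' →
      B ∈ M' → support M' ⊆ E' → False := by
    rintro E E' x hEW hEW' hE ⟨N', hN', hAN', hNE⟩ hsub M' hM' hBM' hME'
    have h1 := hR E hEW hE N' hN' hAN' hNE
    refine hf.not_covered hY hd hN' hAN' (support_subset_iff.1 (h1 ▸ hEW)) hM' hBM'
      (support_subset_iff.1 (hME'.trans hEW')) ?_ x (support_subset_iff.1
        (h1 ▸ hME'.trans hsub))
    rw [h1, hE]
    exact hmin
  obtain ⟨E, E', x, hEW, hEW', hE, -, -, hE'I, hRE, hRE', hsub⟩ :=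
    exists_linear_relation (hlin (support N).card) (fun f hf e he => monomial_mem_squarefreePower
      hf he) R hNW' hDW rfl hDc (sqfreeMonomial_mem_squarefreePower hN subset_rfl)
      (sqfreeMonomial_mem_squarefreePower hM hMD) ⟨N, hN, hAN, subset_rfl⟩
      -- No exchange is needed here, so the extra vertex `s` is arbitrary.
      (fun hRD => key D D s hDW hDW hDc hRD (Finset.subset_insert _ _) M hM hBM hMD)
  obtain ⟨M', hM', hME'⟩ := sqfreeMonomial_mem_squarefreePower_iff.1 hE'I
  rcases hf.mem_or_mem hY hd hM' (support_subset_iff.1 (hME'.trans hEW')) with h1 | h1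
  · exact hRE' ⟨M', hM', h1, hME'⟩
  · exact key E E' x hEW hEW' hE hRE hsub M' hM' h1 hME'

theorem Fork.not_isComponentwiseLinear {par' : V → V} {h' : V → ℕ} {C' : Set V}
    (hf : Fork par h Δ s A B C) (hf' : Fork par' h' Δ s B A C') {k : ℕ} {Y : Finset (Finset V)}
    (hY : IsMatching Δ k Y) (hA : IsMatching Δ (k + 1) (insert A Y))
    (hB : IsMatching Δ (k + 1) (insert B Y)) :
    ¬ IsComponentwiseLinear (squarefreePower (facetIdeal K Δ) (k + 1)) := by
  have hdisj : ∀ D, IsMatching Δ (k + 1) (insert D Y) → ∀ F ∈ Y, Disjoint F D := by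
    intro D hD F hF
    refine hD.2.1 F (Finset.mem_insert_of_mem hF) D (Finset.mem_insert_self _ _) ?_
    rintro rfl
    have h1 := hD.2.2
    rw [Finset.insert_eq_of_mem hF, hY.2.2] at h1
    omega
  have hd : ∀ F ∈ Y, Disjoint F (A ∪ B) := fun F hF =>
    Finset.disjoint_union_right.2 ⟨hdisj A hA F hF, hdisj B hB F hF⟩
  have hAW : ∀ F ∈ insert A Y, F ⊆ A ∪ B ∪ support Y := by
    intro F hF
    rcases Finset.mem_insert.1 hF with rfl | hF
    · exact Finset.subset_union_left.trans Finset.subset_union_left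
    · exact (subset_support hF).trans Finset.subset_union_right
  have hBW : ∀ F ∈ insert B Y, F ⊆ A ∪ B ∪ support Y := by
    intro F hF
    rcases Finset.mem_insert.1 hF with rfl | hF
    · exact Finset.subset_union_right.trans Finset.subset_union_left
    · exact (subset_support hF).trans Finset.subset_union_right
  obtain ⟨N, ⟨hN, hAN, hNW⟩, hNmin⟩ := exists_min_isMatching hA (Finset.mem_insert_self _ _) hAW
  obtain ⟨M, ⟨hM, hBM, hMW⟩, hMmin⟩ := exists_min_isMatching hB (Finset.mem_insert_self _ _) hBW
  -- The facet whose smallest matching covers more vertices plays the role of `A`; hence a fork is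
  -- needed in both orientations.
  rcases le_total (support M).card (support N).card with hle | hle
  · exact hf.not_isComponentwiseLinear_of_le hY hd hN hAN hNW hNmin hM hBM hMW hle
  · rw [Finset.union_comm A B] at hd hNW hMW hMmin
    exact hf'.not_isComponentwiseLinear_of_le hY hd hM hBM hMW hMmin hN hAN hNW hle

end Main

end CNI

end

theorem theorem4p1 {V : Type*} [Fintype V] [DecidableEq V] {K : Type*} [Field K]
    (T : SimpleGraph V) [DecidableRel T.Adj] (hT : T.IsTree) (hC1 : ¬ CNI.ConditionC1 T) :
    ¬ CNI.IsComponentwiseLinear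
      (CNI.squarefreePower (CNI.closedNbhdIdeal K T)
        (CNI.matchingNumber (CNI.closedNbhdComplex T))) := by
  obtain ⟨r₁, r, s, t, t₁, hnd, hr, hrs, hst, ht, hdeg, k, Y, hk, hY, hA, hB, -⟩ := not_not.1 hC1
  simp only [List.nodup_cons, List.mem_cons, List.not_mem_nil, or_false, not_or] at hnd
  rw [← hk] at hA hB ⊢
  have hrt : r ≠ t := hnd.2.1.2.1
  have hFr := hA.1 _ (Finset.mem_insert_self _ _)
  have hFt := hB.1 _ (Finset.mem_insert_self _ _)
  obtain ⟨_, _, _, hf⟩ := CNI.exists_fork hT hrs hst ht hrt hnd.2.2.1.2 hdeg hFr hFt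
  obtain ⟨_, _, _, hf'⟩ := CNI.exists_fork hT hst.symm hrs.symm hr.symm hrt.symm
    (Ne.symm hnd.1.2.1) hdeg hFt hFr
  exact hf.not_isComponentwiseLinear hf' hY hA hB
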